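/- Call a subset $A$ of a field $\mathbb{F}$ *sum-free* if $A \cap (A+A) = \varnothing$, where $A + A = \{a+b : a, b \in A\}$, and *closed under inverses* if $0 \notin A$ and $A = A^{-1}$, where $A^{-1} = \{a^{-1} : a \in A\}$. There exist an absolute constant $c > 0$ and a function $g \colon \mathbb{N} \to \mathbb{R}$ with $g(n) = o(n)$ as $n \to \infty$ such that, for every field $\mathbb{F}$ of prime order and every $A \subseteq \mathbb{F}^* = \mathbb{F} \setminus \{0\}$ which is sum-free and closed under inverses, $$|A| < (0.25 - c)\,|\mathbb{F}| + g(|\mathbb{F}|).$$ -/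

import Mathlib

open Asymptotics
open scoped Pointwise

/-- A set `A` is sum-free if `A ∩ (A + A) = ∅`, where `A + A = {a + b : a, b ∈ A}`
(the summands `a` and `b` may coincide). -/
def IsSumFree {F : Type*} [Add F] (A : Set F) : Prop :=
  A ∩ (A + A) = ∅

/-- A subset `A` of a field is closed under multiplicative inverses if `0 ∉ A` and
`A = A⁻¹`, where `A⁻¹ = {a⁻¹ : a ∈ A}`. -/
def IsInverseClosed {F : Type*} [Field F] (A : Set F) : Prop :=
  (0 : F) ∉ A ∧ A = A⁻¹

/-!
Averages are over the whole field `F = ZMod p`, with `0⁻¹ = 0`. Write `f` for the indicator of `A`,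
`α` for its mean, and `g = f * f` for the normalised additive convolution. Since `A` is
sum-free, `g` vanishes on `A`, and since `A = A⁻¹` it also vanishes at `x⁻¹` for `x ∈ A`. Hence for
`h = (1 - g) ^ k` there is the domination `f x ≤ h x * h x⁻¹`.

The Fourier coefficients of `g` are absolutely summable with sum at most `1`, so those of `h` have
sum at most `2 ^ k`, independently of `p`. For functions of this kind (`WienerBound`), Kloosterman's
elementary bound `O(p ^ (3 / 4))` for `∑ ψ (r x + s x⁻¹)` makes `h x` and `h x⁻¹` asymptotically
independent (`WienerBound.abs_expect_mul_inv_sub_le`). With `ν` the mean of `h` this gives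
`α ≤ ν ^ 2 + o(1)`. As `h` is tiny wherever `A + A` has many representations, Pollard's theorem
(`pollard`) gives `ν ≤ 1 - 2 α` up to a small error, and the two inequalities force `α ≤ 1 / 4` up
to a small error.

To gain a constant, suppose `α` is close to `1 / 4`. Then both inequalities are nearly equalities,
`ν` is close to `1 / 2`, and `f` is nearly indistinguishable from `ν h` when tested against functions
with absolutely summable Fourier coefficients (`expect_mul_ge_of_le_mul_inv`). The Schur triple
count `𝔼 f * (f * f)` is zero, and replacing `f` by `ν h` in one argument at a time shows that `h` has
almost no Schur triples (`expect_pow_three_mul_schur_le`). But `h` has mean about `1 / 2 > 1 / 3`,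
so by Pollard's theorem it has a positive density of them (`expect_mul_meanConv_self_ge`).
-/

/-! ### A bound for Kloosterman sums -/

section Kloosterman

open Finset

variable {F : Type*} [Field F] [Fintype F]

/-- The sum `∑ x, ψ (r x + s x⁻¹)`. The point `x = 0` is included, with `0⁻¹ = 0`, so that `x ↦ x⁻¹`
is a bijection of the range of summation. -/
noncomputable def kloostermanSum (ψ : AddChar F ℂ) (r s : F) : ℂ := ∑ x, ψ (r * x + s * x⁻¹)

lemma kloostermanSum_scale (ψ : AddChar F ℂ) (r s : F) (a : Fˣ) :
    kloostermanSum ψ (a * r) ((a : F)⁻¹ * s) = kloostermanSum ψ r s := by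
  refine Fintype.sum_equiv (Equiv.mulLeft₀ (a : F) a.ne_zero) _ _ fun x => ?_
  congr 1
  simp only [Equiv.mulLeft₀_apply, mul_inv]
  ring

variable [DecidableEq F]

/-- Parseval's identity on `F × F`, for the counting measure of a family of points
`(α i, β i)`. -/
lemma sum_norm_sq_sum_addChar {ι : Type*} [Fintype ι] {ψ : AddChar F ℂ} (hψ : ψ.IsPrimitive)
    (α β : ι → F) :
    ∑ r, ∑ s, ‖∑ i, ψ (r * α i + s * β i)‖ ^ 2 =
      (Fintype.card F : ℝ) ^ 2 * ∑ i, (#{j | α i = α j ∧ β i = β j} : ℝ) := by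
  have key : ∀ i j, ∑ r, ∑ s, ψ (r * α i + s * β i) * (starRingEnd ℂ) (ψ (r * α j + s * β j)) =
      (Fintype.card F : ℂ) ^ 2 * if α i = α j ∧ β i = β j then 1 else 0 := by
    intro i j
    have : ∀ r s, ψ (r * α i + s * β i) * (starRingEnd ℂ) (ψ (r * α j + s * β j)) =
        ψ (r * (α i - α j)) * ψ (s * (β i - β j)) := by
      intro r s
      rw [← AddChar.map_neg_eq_conj, ← AddChar.map_add_eq_mul, ← AddChar.map_add_eq_mul]
      congr 1; ring
    simp_rw [this, ← Finset.mul_sum, ← Finset.sum_mul, AddChar.sum_mulShift _ hψ, sub_eq_zero]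
    split_ifs <;> simp_all [sq]
  have hC : ((∑ r, ∑ s, ‖∑ i, ψ (r * α i + s * β i)‖ ^ 2 : ℝ) : ℂ) =
      (Fintype.card F : ℂ) ^ 2 * ∑ i, (#{j | α i = α j ∧ β i = β j} : ℂ) := by
    push_cast
    simp_rw [← Complex.mul_conj', map_sum, Finset.sum_mul_sum]
    calc _ = ∑ i, ∑ j, ∑ r, ∑ s,
          ψ (r * α i + s * β i) * (starRingEnd ℂ) (ψ (r * α j + s * β j)) := by
          simp_rw [Finset.sum_comm (s := (univ : Finset F)) (t := (univ : Finset ι))]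
      _ = _ := by
          simp_rw [key, ← Finset.mul_sum, Finset.sum_boole]
  exact_mod_cast hC

lemma card_inv_add_inv_sub_le {a b : F} (hab : a ≠ 0 ∨ b ≠ 0) :
    #{x : F | x⁻¹ + (a - x)⁻¹ = b} ≤ 4 := by
  by_cases h : ∃ x₀, x₀ ≠ 0 ∧ a - x₀ ≠ 0 ∧ x₀⁻¹ + (a - x₀)⁻¹ = b
  · obtain ⟨x₀, h0, h1, h2⟩ := h
    refine (card_le_card (t := {0, a, x₀, a - x₀}) fun x hx => ?_).trans card_le_four
    simp only [mem_filter, mem_univ, true_and] at hx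
    simp only [mem_insert, mem_singleton]
    by_cases hx0 : x = 0
    · exact Or.inl hx0
    by_cases hx1 : a - x = 0
    · exact Or.inr (Or.inl (sub_eq_zero.1 hx1).symm)
    have e1 : a = b * (x * (a - x)) := by rw [← hx]; field_simp; ring
    have e2 : a = b * (x₀ * (a - x₀)) := by rw [← h2]; field_simp; ring
    have hb : b ≠ 0 := by
      intro hb
      rw [hb, zero_mul] at e1
      exact hab.elim (fun h => h e1) fun h => h hb
    have e3 := mul_left_cancel₀ hb (e1.symm.trans e2)
    have e4 : (x - x₀) * (x - (a - x₀)) = 0 := by linear_combination -e3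
    rcases mul_eq_zero.1 e4 with h | h
    · exact Or.inr (Or.inr (Or.inl (sub_eq_zero.1 h)))
    · exact Or.inr (Or.inr (Or.inr (sub_eq_zero.1 h)))
  · push Not at h
    refine (card_le_card (t := {0, a}) fun x hx => ?_).trans (card_le_two.trans (by norm_num))
    simp only [mem_filter, mem_univ, true_and] at hx
    simp only [mem_insert, mem_singleton]
    by_contra! hne
    exact h x hne.1 (sub_ne_zero.2 hne.2.symm) hx

lemma card_add_eq_inv_add_inv_eq_le :
    ∑ i : F × F, #{j : F × F | i.1 + i.2 = j.1 + j.2 ∧ i.1⁻¹ + i.2⁻¹ = j.1⁻¹ + j.2⁻¹} ≤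
      5 * Fintype.card F ^ 2 := by
  set q := Fintype.card F
  have inj : ∀ i : F × F,
      #{j : F × F | i.1 + i.2 = j.1 + j.2 ∧ i.1⁻¹ + i.2⁻¹ = j.1⁻¹ + j.2⁻¹} ≤
        #{x : F | x⁻¹ + (i.1 + i.2 - x)⁻¹ = i.1⁻¹ + i.2⁻¹} := by
    intro i
    refine card_le_card_of_injOn Prod.fst (fun j hj => ?_) fun j hj k hk hjk => ?_
    · simp only [coe_filter, Set.mem_ofPred_eq, mem_univ, true_and] at hj ⊢
      rw [hj.1, hj.2, add_sub_cancel_left]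
    · simp only [coe_filter, Set.mem_ofPred_eq, mem_univ, true_and] at hj hk
      refine Prod.ext hjk ?_
      have := hj.1.symm.trans hk.1
      rw [hjk] at this
      exact add_left_cancel this
  have bd : ∀ i : F × F,
      #{j : F × F | i.1 + i.2 = j.1 + j.2 ∧ i.1⁻¹ + i.2⁻¹ = j.1⁻¹ + j.2⁻¹} ≤
        4 + if i.1 + i.2 = 0 then q else 0 := by
    intro i
    refine (inj i).trans ?_
    split_ifs with h
    · exact (card_le_univ _).trans (Nat.le_add_left _ _)
    · exact card_inv_add_inv_sub_le (Or.inl h)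
  refine (sum_le_sum fun i _ => bd i).trans ?_
  rw [sum_add_distrib, Fintype.sum_prod_type (fun i : F × F => if i.1 + i.2 = 0 then q else 0)]
  simp only [add_eq_zero_iff_eq_neg', sum_const, card_univ, Fintype.card_prod, smul_eq_mul,
    sum_ite_eq', mem_univ, if_true]
  nlinarith

/-- Kloosterman's fourth-moment bound. Scaling puts `card F - 1` equal values in the fourth
moment over all `(r, s)`, which counts solutions of
`x₁ + x₂ = x₃ + x₄`, `x₁⁻¹ + x₂⁻¹ = x₃⁻¹ + x₄⁻¹`. -/
lemma norm_kloostermanSum_pow_four_le {ψ : AddChar F ℂ} (hψ : ψ.IsPrimitive) {r s : F}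
    (hrs : r ≠ 0 ∨ s ≠ 0) :
    ((Fintype.card F : ℝ) - 1) * ‖kloostermanSum ψ r s‖ ^ 4 ≤ 5 * (Fintype.card F : ℝ) ^ 4 := by
  have hsq : ∀ r s, ‖kloostermanSum ψ r s‖ ^ 4 =
      ‖∑ i : F × F, ψ (r * (i.1 + i.2) + s * (i.1⁻¹ + i.2⁻¹))‖ ^ 2 := by
    intro r s
    rw [show (4 : ℕ) = 2 * 2 from rfl, pow_mul, ← norm_pow, sq (kloostermanSum ψ r s),
      kloostermanSum, Finset.sum_mul_sum, Fintype.sum_prod_type]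
    congr 2
    refine Finset.sum_congr rfl fun x _ => Finset.sum_congr rfl fun y _ => ?_
    rw [← AddChar.map_add_eq_mul]
    congr 1; ring
  have hinj : Function.Injective fun a : Fˣ => ((a : F) * r, ((a⁻¹ : Fˣ) : F) * s) := by
    intro a b hab
    simp only [Prod.mk.injEq] at hab
    rcases hrs with h | h
    · exact Units.ext (mul_right_cancel₀ h hab.1)
    · exact inv_injective (Units.ext (mul_right_cancel₀ h hab.2))
  calc ((Fintype.card F : ℝ) - 1) * ‖kloostermanSum ψ r s‖ ^ 4
      = ∑ a : Fˣ, ‖kloostermanSum ψ (a * r) (((a⁻¹ : Fˣ) : F) * s)‖ ^ 4 := by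
        have : ∀ a : Fˣ, kloostermanSum ψ (a * r) (((a⁻¹ : Fˣ) : F) * s) = kloostermanSum ψ r s :=
          fun a => by rw [Units.val_inv_eq_inv_val, kloostermanSum_scale]
        simp only [this, sum_const, card_univ, Fintype.card_units, nsmul_eq_mul]
        rw [Nat.cast_sub Fintype.card_pos, Nat.cast_one]
    _ ≤ ∑ z : F × F, ‖kloostermanSum ψ z.1 z.2‖ ^ 4 := by
        rw [← Finset.sum_image (f := fun z : F × F => ‖kloostermanSum ψ z.1 z.2‖ ^ 4)
          (s := univ) (g := fun a : Fˣ => ((a : F) * r, ((a⁻¹ : Fˣ) : F) * s)) hinj.injOn]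
        exact sum_le_sum_of_subset_of_nonneg (subset_univ _) fun _ _ _ => by positivity
    _ = (Fintype.card F : ℝ) ^ 2 * ∑ i : F × F,
          (#{j : F × F | i.1 + i.2 = j.1 + j.2 ∧ i.1⁻¹ + i.2⁻¹ = j.1⁻¹ + j.2⁻¹} : ℝ) := by
        rw [Fintype.sum_prod_type, ← sum_norm_sq_sum_addChar hψ]
        simp_rw [hsq]
    _ ≤ (Fintype.card F : ℝ) ^ 2 * (5 * (Fintype.card F : ℝ) ^ 2) := by
        gcongr
        exact_mod_cast card_add_eq_inv_add_inv_eq_le (F := F)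
    _ = _ := by ring

end Kloosterman

/-! ### Absolutely summable Fourier expansions and inversion -/

section Wiener

open Finset
open scoped BigOperators

variable {F : Type*} [Field F] [Fintype F]

/-- The function `u` has Wiener norm (the `ℓ¹` norm of the Fourier coefficients) at most `K`.
The coefficients are given by any expansion of `u`, so that no inversion formula is
needed to bound the norm of a product. -/
def WienerBound (ψ : AddChar F ℂ) (u : F → ℝ) (K : ℝ) : Prop :=
  ∃ c : F → ℂ, (∀ x, (u x : ℂ) = ∑ r, c r * ψ (r * x)) ∧ ∑ r, ‖c r‖ ≤ K

/-- The convolution of `u` and `v` on the additive group of `F`, normalised by averaging. -/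
noncomputable def meanConv (u v : F → ℝ) (x : F) : ℝ := 𝔼 y, u y * v (x - y)

variable {ψ : AddChar F ℂ} {u v : F → ℝ} {K L : ℝ}

lemma WienerBound.nonneg (hu : WienerBound ψ u K) : 0 ≤ K := by
  obtain ⟨c, -, hK⟩ := hu
  exact (sum_nonneg fun _ _ => norm_nonneg _).trans hK

lemma WienerBound.sub (hu : WienerBound ψ u K) (hv : WienerBound ψ v L) :
    WienerBound ψ (fun x => u x - v x) (K + L) := by
  obtain ⟨c, hc, hK⟩ := hu
  obtain ⟨d, hd, hL⟩ := hv
  refine ⟨fun r => c r - d r, fun x => ?_, ?_⟩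
  · push_cast
    simp_rw [hc, hd, sub_mul, sum_sub_distrib]
  · calc _ ≤ ∑ r, (‖c r‖ + ‖d r‖) := sum_le_sum fun r _ => norm_sub_le _ _
      _ ≤ _ := by rw [sum_add_distrib]; exact add_le_add hK hL

lemma WienerBound.mul (hu : WienerBound ψ u K) (hv : WienerBound ψ v L) :
    WienerBound ψ (fun x => u x * v x) (K * L) := by
  have hK0 := hu.nonneg
  obtain ⟨c, hc, hK⟩ := hu
  obtain ⟨d, hd, hL⟩ := hv
  refine ⟨fun r => ∑ s, c s * d (r - s), fun x => ?_, ?_⟩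
  · push_cast
    simp_rw [hc, hd, sum_mul_sum, sum_mul]
    conv_rhs => rw [sum_comm]
    refine sum_congr rfl fun s _ => ?_
    refine Fintype.sum_equiv (Equiv.addRight s) _ _ fun r => ?_
    simp only [Equiv.coe_addRight, add_sub_cancel_right, add_mul, AddChar.map_add_eq_mul]
    ring
  · calc ∑ r, ‖∑ s, c s * d (r - s)‖ ≤ ∑ r, ∑ s, ‖c s‖ * ‖d (r - s)‖ := by
          refine sum_le_sum fun r _ => (norm_sum_le _ _).trans_eq ?_
          simp_rw [norm_mul]
      _ = (∑ s, ‖c s‖) * ∑ r, ‖d r‖ := by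
          rw [sum_comm, sum_mul]
          refine sum_congr rfl fun s _ => ?_
          rw [← mul_sum]
          congr 1
          exact Fintype.sum_equiv (Equiv.subRight s) _ _ fun r => rfl
      _ ≤ K * L := mul_le_mul hK hL (sum_nonneg fun _ _ => norm_nonneg _) hK0

variable [DecidableEq F]

lemma WienerBound.one : WienerBound ψ (fun _ => 1) 1 :=
  ⟨fun r => if r = 0 then 1 else 0, fun x => by simp, by simp [apply_ite]⟩

lemma WienerBound.pow (hu : WienerBound ψ u K) (k : ℕ) :
    WienerBound ψ (fun x => u x ^ k) (K ^ k) := by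
  induction k with
  | zero => simpa using WienerBound.one
  | succ k ih => simpa only [pow_succ] using ih.mul hu

/-- Parseval's identity gives the Fourier coefficients of a function bounded by `1` an `ℓ²` norm
of at most `1`. -/
lemma sum_norm_sq_expect_le_one (hψ : ψ.IsPrimitive) (hu : ∀ x, |u x| ≤ 1) :
    ∑ r, ‖(∑ y, (u y : ℂ) * ψ (-(r * y))) / Fintype.card F‖ ^ 2 ≤ 1 := by
  have hq : (0 : ℝ) < Fintype.card F := by exact_mod_cast Fintype.card_pos
  have hpars : ∑ r, ‖∑ y, (u y : ℂ) * ψ (-(r * y))‖ ^ 2 = Fintype.card F * ∑ y, u y ^ 2 := by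
    have hC : ((∑ r, ‖∑ y, (u y : ℂ) * ψ (-(r * y))‖ ^ 2 : ℝ) : ℂ) =
        Fintype.card F * ∑ y, (u y : ℂ) ^ 2 := by
      push_cast
      have key : ∀ y z, ∑ r, (u y : ℂ) * ψ (-(r * y)) *
          (starRingEnd ℂ) ((u z : ℂ) * ψ (-(r * z))) =
          if y = z then (Fintype.card F : ℂ) * (u y * u z) else 0 := by
        intro y z
        have : ∀ r, (u y : ℂ) * ψ (-(r * y)) * (starRingEnd ℂ) ((u z : ℂ) * ψ (-(r * z))) =
            u y * u z * ψ (r * (z - y)) := by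
          intro r
          rw [map_mul, Complex.conj_ofReal, ← AddChar.map_neg_eq_conj,
            show r * (z - y) = -(r * y) + - -(r * z) by ring, AddChar.map_add_eq_mul]
          ring
        simp_rw [this, ← mul_sum, AddChar.sum_mulShift _ hψ, sub_eq_zero, eq_comm (a := z)]
        split_ifs <;> simp [mul_comm]
      simp_rw [← Complex.mul_conj', map_sum, sum_mul_sum]
      calc _ = ∑ y, ∑ z, ∑ r, (u y : ℂ) * ψ (-(r * y)) *
            (starRingEnd ℂ) ((u z : ℂ) * ψ (-(r * z))) := by
            rw [sum_comm]
            exact sum_congr rfl fun y _ => sum_comm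
        _ = _ := by
            simp_rw [key, sum_ite_eq, mem_univ, if_true, ← mul_sum, sq]
    exact_mod_cast hC
  simp_rw [norm_div, div_pow, ← sum_div, Complex.norm_natCast]
  rw [div_le_one (by positivity), hpars, sq]
  gcongr
  calc ∑ y, u y ^ 2 ≤ ∑ _y : F, (1 : ℝ) :=
        sum_le_sum fun y _ => (sq_le_one_iff_abs_le_one _).2 (hu y)
    _ = _ := by simp

lemma wienerBound_meanConv (hψ : ψ.IsPrimitive) (hu : ∀ x, |u x| ≤ 1) (hv : ∀ x, |v x| ≤ 1) :
    WienerBound ψ (meanConv u v) 1 := by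
  have hq : (Fintype.card F : ℂ) ≠ 0 := by exact_mod_cast Fintype.card_ne_zero
  refine ⟨fun r => (∑ y, (u y : ℂ) * ψ (-(r * y))) / Fintype.card F *
    ((∑ z, (v z : ℂ) * ψ (-(r * z))) / Fintype.card F), fun x => ?_, ?_⟩
  · rw [meanConv, Fintype.expect_eq_sum_div_card]
    push_cast
    have key : ∀ y z, ∑ r, (u y : ℂ) * ψ (-(r * y)) * ((v z : ℂ) * ψ (-(r * z))) * ψ (r * x) =
        if x - y = z then (Fintype.card F : ℂ) * (u y * v z) else 0 := by
      intro y z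
      have : ∀ r, (u y : ℂ) * ψ (-(r * y)) * ((v z : ℂ) * ψ (-(r * z))) * ψ (r * x) =
          u y * v z * ψ (r * (x - y - z)) := by
        intro r
        rw [show r * (x - y - z) = -(r * y) + -(r * z) + r * x by ring, AddChar.map_add_eq_mul,
          AddChar.map_add_eq_mul]
        ring
      simp_rw [this, ← mul_sum, AddChar.sum_mulShift _ hψ, sub_eq_zero]
      split_ifs <;> simp [mul_comm]
    have hsum : ∑ r, (∑ y, (u y : ℂ) * ψ (-(r * y))) * (∑ z, (v z : ℂ) * ψ (-(r * z))) * ψ (r * x) =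
        Fintype.card F * ∑ y, (u y : ℂ) * v (x - y) := by
      simp_rw [sum_mul_sum, sum_mul]
      calc _ = ∑ y, ∑ z, ∑ r, (u y : ℂ) * ψ (-(r * y)) * ((v z : ℂ) * ψ (-(r * z))) * ψ (r * x) := by
            rw [sum_comm]
            exact sum_congr rfl fun y _ => sum_comm
        _ = _ := by
            simp_rw [key, sum_ite_eq, mem_univ, if_true, ← mul_sum]
    have hrw : ∀ r, (∑ y, (u y : ℂ) * ψ (-(r * y))) / Fintype.card F *
        ((∑ z, (v z : ℂ) * ψ (-(r * z))) / Fintype.card F) * ψ (r * x) =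
        (∑ y, (u y : ℂ) * ψ (-(r * y))) * (∑ z, (v z : ℂ) * ψ (-(r * z))) * ψ (r * x) /
          ((Fintype.card F : ℂ) * Fintype.card F) := by
      intro r; field_simp
    simp_rw [hrw, ← sum_div, hsum]
    field_simp
  · have h1 := sum_norm_sq_expect_le_one hψ hu
    have h2 := sum_norm_sq_expect_le_one hψ hv
    refine (sum_le_sum fun r _ => ?_).trans
      (show ∑ r, (‖(∑ y, (u y : ℂ) * ψ (-(r * y))) / Fintype.card F‖ ^ 2 / 2 +
        ‖(∑ y, (v y : ℂ) * ψ (-(r * y))) / Fintype.card F‖ ^ 2 / 2) ≤ 1 from ?_)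
    · rw [norm_mul]
      nlinarith [sq_nonneg (‖(∑ y, (u y : ℂ) * ψ (-(r * y))) / Fintype.card F‖ -
        ‖(∑ y, (v y : ℂ) * ψ (-(r * y))) / Fintype.card F‖)]
    · rw [sum_add_distrib, ← sum_div, ← sum_div]
      linarith

/-- Functions with bounded Wiener norm become independent of each other when one of them is
precomposed with inversion, because the Kloosterman sums are small. -/
lemma WienerBound.abs_expect_mul_inv_sub_le (hψ : ψ.IsPrimitive) {κ : ℝ}
    (hκ : ∀ r s, r ≠ 0 ∨ s ≠ 0 → ‖kloostermanSum ψ r s‖ ≤ κ * Fintype.card F)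
    (hu : WienerBound ψ u K) (hv : WienerBound ψ v L) :
    |𝔼 x, u x * v x⁻¹ - (𝔼 x, u x) * 𝔼 x, v x| ≤ K * L * κ := by
  have hK0 := hu.nonneg
  have hqp : (0 : ℝ) < Fintype.card F := by exact_mod_cast Fintype.card_pos
  have hq : (Fintype.card F : ℂ) ≠ 0 := by exact_mod_cast Fintype.card_ne_zero
  have hκ0 : 0 ≤ κ * Fintype.card F := (norm_nonneg _).trans (hκ 1 0 (Or.inl one_ne_zero))
  obtain ⟨c, hc, hK⟩ := hu
  obtain ⟨d, hd, hL⟩ := hv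
  have hmean : ∀ e : F → ℂ, ∑ x, ∑ r, e r * ψ (r * x) = Fintype.card F * e 0 := by
    intro e
    have hs : ∀ r, ∑ x, ψ (r * x) = ((if r = 0 then Fintype.card F else 0 : ℕ) : ℂ) := by
      intro r
      simp_rw [mul_comm r, AddChar.sum_mulShift r hψ]
    rw [sum_comm]
    simp_rw [← mul_sum, hs]
    simp [mul_comm]
  have hcorr : ∑ x, (u x : ℂ) * v x⁻¹ = ∑ r, ∑ s, c r * d s * kloostermanSum ψ r s := by
    simp_rw [hc, hd, sum_mul_sum, kloostermanSum, mul_sum]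
    rw [sum_comm]
    refine sum_congr rfl fun r _ => ?_
    rw [sum_comm]
    refine sum_congr rfl fun s _ => sum_congr rfl fun x _ => ?_
    rw [AddChar.map_add_eq_mul]
    ring
  have hdiff : ∑ x, (u x : ℂ) * v x⁻¹ - Fintype.card F * (c 0 * d 0) =
      ∑ r, ∑ s, c r * d s *
        (kloostermanSum ψ r s - if r = 0 then if s = 0 then (Fintype.card F : ℂ) else 0 else 0) := by
    simp_rw [mul_sub, sum_sub_distrib, hcorr]
    congr 1
    simp [mul_ite, mul_comm]
  have hbound : ‖∑ x, (u x : ℂ) * v x⁻¹ - Fintype.card F * (c 0 * d 0)‖ ≤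
      K * L * (κ * Fintype.card F) := by
    rw [hdiff]
    calc _ ≤ ∑ r, ∑ s, ‖c r‖ * ‖d s‖ * (κ * Fintype.card F) := by
          refine (norm_sum_le _ _).trans (sum_le_sum fun r _ => ?_)
          refine (norm_sum_le _ _).trans (sum_le_sum fun s _ => ?_)
          rw [norm_mul, norm_mul]
          refine mul_le_mul_of_nonneg_left ?_ (by positivity)
          by_cases h : r = 0 ∧ s = 0
          · simpa [h.1, h.2, kloostermanSum] using hκ0
          · have h0 : (if r = 0 then if s = 0 then (Fintype.card F : ℂ) else 0 else 0) = 0 := by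
              split_ifs <;> simp_all
            rw [h0, sub_zero]
            exact hκ r s (by tauto)
      _ = (∑ r, ‖c r‖) * (∑ s, ‖d s‖) * (κ * Fintype.card F) := by
          simp_rw [sum_mul_sum, sum_mul]
      _ ≤ _ := mul_le_mul_of_nonneg_right
          (mul_le_mul hK hL (sum_nonneg fun _ _ => norm_nonneg _) hK0) hκ0
  have hcast : ((𝔼 x, u x * v x⁻¹ - (𝔼 x, u x) * 𝔼 x, v x : ℝ) : ℂ) =
      (∑ x, (u x : ℂ) * v x⁻¹ - Fintype.card F * (c 0 * d 0)) / Fintype.card F := by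
    simp_rw [Fintype.expect_eq_sum_div_card]
    push_cast
    rw [show ∑ x, (u x : ℂ) = Fintype.card F * c 0 by rw [← hmean c]; simp_rw [hc],
      show ∑ x, (v x : ℂ) = Fintype.card F * d 0 by rw [← hmean d]; simp_rw [hd]]
    field_simp
  rw [← Real.norm_eq_abs, ← Complex.norm_real, hcast, norm_div, Complex.norm_natCast,
    div_le_iff₀ hqp]
  linarith

end Wiener

/-! ### Pollard's theorem -/

section Pollard

open Finset

/-- The number of representations `x = a + b` with `a ∈ A` and `b ∈ B`. -/
def repCount {G : Type*} [AddCommGroup G] [DecidableEq G] (A B : Finset G) (x : G) : ℕ :=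
  #{a ∈ A | x - a ∈ B}

lemma repCount_le_card_left {G : Type*} [AddCommGroup G] [DecidableEq G] (A B : Finset G) (x : G) :
    repCount A B x ≤ #A := card_filter_le _ _

variable {G : Type*} [AddCommGroup G] [Fintype G] [DecidableEq G]

lemma repCount_eq_sum (A B : Finset G) (x : G) :
    repCount A B x = ∑ a, if a ∈ A ∧ x - a ∈ B then 1 else 0 := by
  rw [repCount, sum_boole, ← filter_filter]
  simp

lemma repCount_comm (A B : Finset G) (x : G) : repCount A B x = repCount B A x := by
  rw [repCount_eq_sum, repCount_eq_sum]
  refine Fintype.sum_equiv (Equiv.subLeft x) _ _ fun a => ?_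
  simp [and_comm]

lemma repCount_le_card_right (A B : Finset G) (x : G) : repCount A B x ≤ #B :=
  repCount_comm A B x ▸ repCount_le_card_left B A x

lemma sum_repCount (A B : Finset G) : ∑ x, repCount A B x = #A * #B := by
  have h : ∀ a, ∑ x, (if a ∈ A ∧ x - a ∈ B then 1 else 0) = if a ∈ A then #B else 0 := by
    intro a
    split_ifs with ha
    · rw [← Fintype.sum_equiv (Equiv.addRight a) (fun b => if b ∈ B then 1 else 0) _ (by simp [ha])]
      simp
    · simp [ha]
  simp_rw [repCount_eq_sum]
  rw [sum_comm]
  simp_rw [h]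
  simp

/-- The representation counts are unchanged in total when `A, B` is replaced by the
Dyson transform `A ∪ B, A ∩ B` together with the leftover pair `A \ B, B \ A`. -/
lemma repCount_eq_add (A B : Finset G) (x : G) :
    repCount A B x = repCount (A ∪ B) (A ∩ B) x + repCount (A \ B) (B \ A) x := by
  have h : repCount A B x + repCount B A x =
      repCount (A ∪ B) (A ∩ B) x + repCount (A ∩ B) (A ∪ B) x +
        (repCount (A \ B) (B \ A) x + repCount (B \ A) (A \ B) x) := by
    simp_rw [repCount_eq_sum, ← sum_add_distrib]
    refine sum_congr rfl fun a _ => ?_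
    simp only [mem_union, mem_inter, mem_sdiff]
    by_cases h1 : a ∈ A <;> by_cases h2 : a ∈ B <;> by_cases h3 : x - a ∈ A <;>
      by_cases h4 : x - a ∈ B <;> simp [h1, h2, h3, h4]
  rw [repCount_comm B A, repCount_comm (A ∩ B), repCount_comm (B \ A)] at h
  omega

lemma sum_min_repCount_translate (A B : Finset G) (t : ℕ) (e : G) :
    ∑ x, min t (repCount A (B.image (· + e)) x) = ∑ x, min t (repCount A B x) := by
  refine Fintype.sum_equiv (Equiv.subRight e) _ _ fun x => ?_
  congr 1
  simp only [repCount, Equiv.subRight_apply]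
  congr 1
  refine filter_congr fun a _ => ?_
  simp only [mem_image]
  constructor
  · rintro ⟨b, hb, h⟩
    rwa [show x - e - a = b by rw [sub_right_comm, ← h, add_sub_cancel_right]]
  · intro h
    exact ⟨_, h, by abel⟩

variable {p : ℕ} [Fact p.Prime]

/-- A translate of `B` meets `A` partially: otherwise `A` would be invariant under the differences
of elements of `B`, which generate `ZMod p`. -/
lemma exists_translate_inter {A B : Finset (ZMod p)} (hA : A.Nonempty) (hAp : #A < p)
    (hB : 1 < #B) :
    ∃ e, (A ∩ B.image (· + e)).Nonempty ∧ #(A ∩ B.image (· + e)) < #B := by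
  by_contra! hcon
  obtain ⟨b₁, hb₁, b₂, hb₂, hne⟩ := one_lt_card.1 hB
  have hd : b₂ - b₁ ≠ 0 := sub_ne_zero.2 hne.symm
  have hstep : ∀ a ∈ A, a + (b₂ - b₁) ∈ A := by
    intro a ha
    have hmem : a ∈ A ∩ B.image (· + (a - b₁)) :=
      mem_inter.2 ⟨ha, mem_image.2 ⟨b₁, hb₁, add_sub_cancel _ _⟩⟩
    have hcard := hcon (a - b₁) ⟨a, hmem⟩
    have heq : A ∩ B.image (· + (a - b₁)) = B.image (· + (a - b₁)) :=
      eq_of_subset_of_card_le inter_subset_right (card_image_le.trans hcard)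
    have : b₂ + (a - b₁) ∈ A ∩ B.image (· + (a - b₁)) := by
      rw [heq]; exact mem_image.2 ⟨b₂, hb₂, rfl⟩
    rw [show a + (b₂ - b₁) = b₂ + (a - b₁) by ring]
    exact (mem_inter.1 this).1
  obtain ⟨a, ha⟩ := hA
  have hmul : ∀ n : ℕ, a + n * (b₂ - b₁) ∈ A := by
    intro n
    induction n with
    | zero => simpa using ha
    | succ n ih =>
      have := hstep _ ih
      rwa [add_assoc, ← add_one_mul, ← Nat.cast_succ] at this
  have huniv : A = univ := by
    refine eq_univ_of_forall fun x => ?_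
    have := hmul ((x - a) / (b₂ - b₁)).val
    rwa [ZMod.natCast_val, ZMod.cast_id, div_mul_cancel₀ _ hd, add_sub_cancel] at this
  rw [huniv, card_univ, ZMod.card] at hAp
  exact lt_irrefl _ hAp

/-- Pollard's theorem, a robust form of the Cauchy–Davenport inequality, in the range
`#A + #B ≤ p + t`: it reads `∑ x, min t (r x) ≥ t (#A + #B - t)` for the representation count `r`
of `A + B`. -/
theorem pollard (A B : Finset (ZMod p)) (t : ℕ) (htA : t ≤ #A) (htB : t ≤ #B)
    (hp : #A + #B ≤ p + t) :
    t * (#A + #B) ≤ ∑ x, min t (repCount A B x) + t * t := by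
  induction hn : #B using Nat.strong_induction_on generalizing A B t with
  | _ n ih =>
  subst hn
  rcases htB.eq_or_lt with rfl | htB'
  · simp_rw [min_eq_right (repCount_le_card_right A B _), sum_repCount]
    exact (by ring : _ = _).le
  rcases Nat.eq_zero_or_pos t with rfl | ht
  · simp
  obtain ⟨e, hne, hlt⟩ := exists_translate_inter (A := A) (B := B)
    (card_pos.1 (ht.trans_le htA)) (by omega) (by omega)
  have hcB : #(B.image (· + e)) = #B := card_image_of_injective _ (add_left_injective e)
  rw [← sum_min_repCount_translate A B t e, ← hcB]
  rw [← hcB] at htB htB' hp hlt ih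
  generalize B.image (· + e) = B' at *
  have hUI : #(A ∪ B') + #(A ∩ B') = #A + #B' := card_union_add_card_inter _ _
  have hI : 0 < #(A ∩ B') := card_pos.2 hne
  rcases le_or_gt t #(A ∩ B') with hcase | hcase
  · have h := ih _ hlt (A ∪ B') (A ∩ B') t (hcase.trans (card_le_card
      (inter_subset_left.trans subset_union_left))) hcase (by omega) rfl
    rw [hUI] at h
    refine h.trans (Nat.add_le_add_right (sum_le_sum fun x _ => min_le_min_left _ ?_) _)
    rw [repCount_eq_add A B' x]
    exact Nat.le_add_right _ _
  · have hA' : #(A \ B') + #(A ∩ B') = #A := card_sdiff_add_card_inter _ _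
    have hB' : #(B' \ A) + #(A ∩ B') = #B' := by
      rw [inter_comm]; exact card_sdiff_add_card_inter _ _
    obtain ⟨s, rfl⟩ := Nat.exists_eq_add_of_lt hcase
    have h := ih #(B' \ A) (by omega) (A \ B') (B' \ A) (s + 1) (by omega) (by omega) (by omega) rfl
    have hsum : ∑ x, min (s + 1) (repCount (A \ B') (B' \ A) x) + #(A ∪ B') * #(A ∩ B') ≤
        ∑ x, min (#(A ∩ B') + s + 1) (repCount A B' x) := by
      rw [← sum_repCount, ← sum_add_distrib]
      refine sum_le_sum fun x _ => ?_
      have h1 := repCount_le_card_right (A ∪ B') (A ∩ B') x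
      rw [repCount_eq_add A B' x]
      omega
    nlinarith

lemma card_schur_triples_ge (S : Finset (ZMod p)) (t : ℕ) (htS : t ≤ #S) (hp : 2 * #S ≤ p + t) :
    t * (3 * #S) ≤ ∑ x ∈ S, repCount S S x + t * p + t * t := by
  have h := pollard S S t htS htS (by omega)
  have hS : ∑ x ∈ S, min t (repCount S S x) ≤ ∑ x ∈ S, repCount S S x :=
    sum_le_sum fun x _ => min_le_right _ _
  have hSc : ∑ x ∈ Sᶜ, min t (repCount S S x) ≤ #Sᶜ * t :=
    sum_le_card_nsmul _ _ _ fun x _ => min_le_left _ _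
  have hc : #Sᶜ + #S = p := by rw [card_compl_add_card, ZMod.card]
  rw [← sum_add_sum_compl S] at h
  nlinarith

end Pollard

/-! ### Functions dominated by `h x * h x⁻¹` -/

section Domination

open Finset
open scoped BigOperators

section Convolution

variable {F : Type*} [Field F] [Fintype F] {u v : F → ℝ}

lemma meanConv_nonneg (hu : ∀ x, 0 ≤ u x) (hv : ∀ x, 0 ≤ v x) (x : F) : 0 ≤ meanConv u v x :=
  expect_nonneg fun _ _ => mul_nonneg (hu _) (hv _)

lemma meanConv_le_one (hu : ∀ x, 0 ≤ u x) (hu1 : ∀ x, u x ≤ 1) (hv1 : ∀ x, v x ≤ 1) (x : F) :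
    meanConv u v x ≤ 1 :=
  expect_le univ_nonempty fun _ _ => (mul_le_of_le_one_right (hu _) (hv1 _)).trans (hu1 _)

lemma meanConv_comm (u v : F → ℝ) : meanConv u v = meanConv v u := by
  funext x
  refine Fintype.expect_equiv (Equiv.subLeft x) _ _ fun y => ?_
  simp [mul_comm]

lemma expect_mul_meanConv_swap (u v w : F → ℝ) :
    𝔼 x, u x * meanConv v w x = 𝔼 x, v x * meanConv u (fun y => w (-y)) x := by
  simp_rw [meanConv, mul_expect]
  rw [expect_comm]
  refine expect_congr rfl fun x _ => expect_congr rfl fun y _ => ?_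
  rw [neg_sub]
  ring

end Convolution

variable {F : Type*} [Field F] [Fintype F] [DecidableEq F] {ψ : AddChar F ℂ} {κ H : ℝ}
  {f h w : F → ℝ}

/-- If `f` is dominated by `h x * h x⁻¹` and has nearly the same mean, then on functions of
bounded Wiener norm `f` looks like `h` times the mean of `h`. -/
lemma expect_mul_ge_of_le_mul_inv (hψ : ψ.IsPrimitive)
    (hκ : ∀ r s, r ≠ 0 ∨ s ≠ 0 → ‖kloostermanSum ψ r s‖ ≤ κ * Fintype.card F)
    (hh : WienerBound ψ h H) (hf : ∀ x, f x ≤ h x * h x⁻¹) (hw : WienerBound ψ w 1)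
    (hw1 : ∀ x, w x ≤ 1) :
    (𝔼 x, h x) * (𝔼 x, h x * w x) - ((𝔼 x, h x) ^ 2 - 𝔼 x, f x + 2 * H ^ 2 * κ) ≤
      𝔼 x, f x * w x := by
  have hW := hh.mul (WienerBound.one.sub hw)
  have hcorr := (abs_le.1 (hW.abs_expect_mul_inv_sub_le hψ hκ hh)).2
  have hle : 𝔼 x, f x * (1 - w x) ≤ 𝔼 x, h x * (1 - w x) * h x⁻¹ := by
    refine expect_le_expect fun x _ => ?_
    have := mul_le_mul_of_nonneg_right (hf x) (sub_nonneg.2 (hw1 x))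
    linarith
  simp_rw [mul_sub, mul_one, expect_sub_distrib] at hle hcorr
  nlinarith

lemma expect_le_sq_of_le_mul_inv (hψ : ψ.IsPrimitive)
    (hκ : ∀ r s, r ≠ 0 ∨ s ≠ 0 → ‖kloostermanSum ψ r s‖ ≤ κ * Fintype.card F)
    (hh : WienerBound ψ h H) (hf : ∀ x, f x ≤ h x * h x⁻¹) :
    𝔼 x, f x ≤ (𝔼 x, h x) ^ 2 + H ^ 2 * κ := by
  have hcorr := (abs_le.1 (hh.abs_expect_mul_inv_sub_le hψ hκ hh)).2
  have hle : 𝔼 x, f x ≤ 𝔼 x, h x * h x⁻¹ := expect_le_expect fun x _ => hf x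
  nlinarith

/-- Replacing `f` by a multiple of `h` in one argument at a time, the density of Schur triples of
`h` is controlled by that of `f`. -/
lemma expect_pow_three_mul_schur_le (hψ : ψ.IsPrimitive)
    (hκ : ∀ r s, r ≠ 0 ∨ s ≠ 0 → ‖kloostermanSum ψ r s‖ ≤ κ * Fintype.card F)
    (hh : WienerBound ψ h H) (hf : ∀ x, f x ≤ h x * h x⁻¹)
    (hf0 : ∀ x, 0 ≤ f x) (hf1 : ∀ x, f x ≤ 1) (hh0 : ∀ x, 0 ≤ h x) (hh1 : ∀ x, h x ≤ 1)
    {η : ℝ} (hη : 0 ≤ η) (hνη : (𝔼 x, h x) ^ 2 - 𝔼 x, f x + 2 * H ^ 2 * κ ≤ η) :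
    (𝔼 x, h x) ^ 3 * (𝔼 x, h x * meanConv h h x) ≤ (𝔼 x, f x * meanConv f f x) + 3 * η := by
  have habs : ∀ {u : F → ℝ}, (∀ x, 0 ≤ u x) → (∀ x, u x ≤ 1) → ∀ x, |u x| ≤ 1 :=
    fun h0 h1 x => abs_le.2 ⟨by linarith [h0 x], h1 x⟩
  have step : ∀ u v : F → ℝ, (∀ x, 0 ≤ u x) → (∀ x, u x ≤ 1) → (∀ x, 0 ≤ v x) → (∀ x, v x ≤ 1) →
      (𝔼 x, h x) * (𝔼 x, h x * meanConv u v x) - η ≤ 𝔼 x, f x * meanConv u v x := by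
    intro u v hu hu1 hv hv1
    have := expect_mul_ge_of_le_mul_inv hψ hκ hh hf
      (wienerBound_meanConv hψ (habs hu hu1) (habs hv hv1)) (meanConv_le_one hu hu1 hv1)
    linarith
  have s1 := step f f hf0 hf1 hf0 hf1
  have s2 := step h (fun x => f (-x)) hh0 hh1 (fun _ => hf0 _) fun _ => hf1 _
  have s3 := step h (fun x => h (-x)) hh0 hh1 (fun _ => hh0 _) fun _ => hh1 _
  rw [← expect_mul_meanConv_swap h f f, ← expect_mul_meanConv_swap h h f, meanConv_comm h f] at s2
  rw [← expect_mul_meanConv_swap h f h, ← expect_mul_meanConv_swap h h h] at s3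
  have hν0 : 0 ≤ 𝔼 x, h x := expect_nonneg fun x _ => hh0 x
  have hν1 : 𝔼 x, h x ≤ 1 := expect_le univ_nonempty fun x _ => hh1 x
  generalize 𝔼 x, h x = ν at *
  have m2 := mul_le_mul_of_nonneg_left s2 hν0
  have m3 := mul_le_mul_of_nonneg_left s3 (mul_nonneg hν0 hν0)
  have e1 := mul_le_mul_of_nonneg_right hν1 hη
  have e2 := mul_le_mul_of_nonneg_left e1 hν0
  nlinarith

end Domination

/-! ### Sum-free sets in prime fields -/

section PrimeField

open Finset
open scoped BigOperators

variable {p : ℕ} [Fact p.Prime]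

/-- A function on `ZMod p` with mean well above `1 / 3` has a positive density of Schur triples. -/
lemma expect_mul_meanConv_self_ge {h : ZMod p → ℝ} (hh0 : ∀ x, 0 ≤ h x) (hh1 : ∀ x, h x ≤ 1)
    (hν : 0.48 ≤ 𝔼 x, h x) (hp : 1000 ≤ p) : 1e-7 ≤ 𝔼 x, h x * meanConv h h x := by
  have hpr : (1000 : ℝ) ≤ p := by exact_mod_cast hp
  have hp0 : (0 : ℝ) < p := by linarith
  -- The superlevel set `L` has density at least `0.48 - 0.02`; Pollard's theorem is applied to a
  -- subset of density `0.45`, so as not to exceed its range `2 #S ≤ p + t`.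
  set L : Finset (ZMod p) := {x | 0.02 ≤ h x} with hL
  have hLcard : 0.46 * (p : ℝ) ≤ #L := by
    have h1 : ∑ x, h x ≤ ∑ x, ((if 0.02 ≤ h x then 1 else 0) + 0.02) := by
      refine sum_le_sum fun x _ => ?_
      split_ifs with hx
      · linarith [hh1 x]
      · linarith
    rw [sum_add_distrib, sum_boole, sum_const, card_univ, ZMod.card, nsmul_eq_mul, ← hL] at h1
    rw [Fintype.expect_eq_sum_div_card, ZMod.card, le_div_iff₀ hp0] at hν
    linarith
  obtain ⟨S, hSL, hS⟩ := exists_subset_card_eq (s := L) (n := 9 * p / 20) (by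
    have : ((9 * p / 20 : ℕ) : ℝ) ≤ #L :=
      (Nat.cast_div_le).trans (by push_cast; linarith)
    exact_mod_cast this)
  have hlow := card_schur_triples_ge S (p / 10) (by omega) (by omega)
  have hscale : (0.02 : ℝ) ^ 3 * (∑ x ∈ S, repCount S S x : ℕ) ≤
      (p : ℝ) ^ 2 * 𝔼 x, h x * meanConv h h x := by
    have hS2 : ∀ x ∈ S, 0.02 ≤ h x := fun x hx => (mem_filter.1 (hSL hx)).2
    have hconv : ∀ x, (0.02 : ℝ) ^ 2 * repCount S S x ≤ p * meanConv h h x := by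
      intro x
      rw [meanConv, Fintype.expect_eq_sum_div_card, ZMod.card, mul_div_cancel₀ _ hp0.ne',
        repCount_eq_sum]
      push_cast
      rw [mul_sum]
      refine sum_le_sum fun y _ => ?_
      split_ifs with hy
      · nlinarith [hS2 _ hy.1, hS2 _ hy.2]
      · simpa using mul_nonneg (hh0 _) (hh0 _)
    rw [Fintype.expect_eq_sum_div_card, ZMod.card, sq (p : ℝ), mul_assoc,
      mul_div_cancel₀ _ hp0.ne', mul_sum]
    push_cast
    rw [mul_sum]
    calc ∑ x ∈ S, (0.02 : ℝ) ^ 3 * repCount S S x ≤ ∑ x ∈ S, p * (h x * meanConv h h x) := by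
          refine sum_le_sum fun x hx => ?_
          have h1 := hconv x
          have h2 : (0 : ℝ) ≤ 0.02 ^ 2 * repCount S S x := by positivity
          nlinarith [hS2 x hx]
      _ ≤ _ := sum_le_sum_of_subset_of_nonneg (subset_univ _) fun x _ _ =>
          mul_nonneg hp0.le (mul_nonneg (hh0 _) (meanConv_nonneg hh0 hh0 _))
  have ht1 : (p : ℝ) / 10 - 1 ≤ (p / 10 : ℕ) := by
    have : (p : ℝ) ≤ 10 * (p / 10 : ℕ) + 10 := by exact_mod_cast (by omega)
    linarith
  have ht2 : ((p / 10 : ℕ) : ℝ) ≤ p / 10 := Nat.cast_div_le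
  have hs1 : (9 * p : ℝ) / 20 - 1 ≤ (#S : ℝ) := by
    have : (9 * p : ℝ) ≤ 20 * (#S : ℝ) + 20 := by rw [hS]; exact_mod_cast (by omega)
    linarith
  have hlowR : ((p / 10 : ℕ) : ℝ) * (3 * #S) ≤
      (∑ x ∈ S, repCount S S x : ℕ) + (p / 10 : ℕ) * (p : ℝ) + (p / 10 : ℕ) * (p / 10 : ℕ) := by
    exact_mod_cast hlow
  generalize ((p / 10 : ℕ) : ℝ) = t at *
  have hR : 0.02 * (p : ℝ) ^ 2 ≤ (∑ x ∈ S, repCount S S x : ℕ) := by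
    have h1 : 0.24 * (p : ℝ) ≤ 3 * #S - p - t := by linarith
    have h2 : 0.09 * (p : ℝ) ≤ t := by linarith
    have h3 := mul_le_mul h2 h1 (by positivity) (by linarith)
    nlinarith
  have hp2 : (0 : ℝ) < (p : ℝ) ^ 2 := by positivity
  by_contra! hcon
  have := mul_lt_mul_of_pos_left hcon hp2
  nlinarith

/-- Pollard's theorem shows that a function which is small wherever `A + A` has many
representations has mean at most about `1 - 2 α`, with `α` the density of `A`. -/
lemma expect_le_of_add_min_repCount_le {A : Finset (ZMod p)} {h : ZMod p → ℝ} {t : ℕ} {ξ : ℝ}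
    (ht : 0 < t) (htA : t ≤ #A) (hA : 2 * #A ≤ p + t)
    (hh : ∀ x, h x + (min t (repCount A A x) : ℕ) / (t : ℝ) ≤ 1 + ξ) :
    𝔼 x, h x ≤ 1 - 2 * (#A / p : ℝ) + t / p + ξ := by
  have hp0 : (0 : ℝ) < p := by exact_mod_cast (Fact.out : p.Prime).pos
  have ht0 : (0 : ℝ) < t := by exact_mod_cast ht
  have hpol : (t : ℝ) * (2 * #A) ≤ (∑ x, min t (repCount A A x) : ℕ) + (t : ℝ) * t := by
    have := pollard A A t htA htA (by omega)
    rw [← two_mul] at this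
    exact_mod_cast this
  have hsum : ∑ x, h x + (∑ x, min t (repCount A A x) : ℕ) / (t : ℝ) ≤ p * (1 + ξ) := by
    have := sum_le_sum fun x (_ : x ∈ univ) => hh x
    rw [sum_add_distrib, sum_const, card_univ, ZMod.card, nsmul_eq_mul, ← sum_div] at this
    exact_mod_cast this
  have hdiv : 2 * (#A : ℝ) - t ≤ (∑ x, min t (repCount A A x) : ℕ) / (t : ℝ) := by
    rw [le_div_iff₀ ht0]
    linarith
  rw [Fintype.expect_eq_sum_div_card, ZMod.card, div_le_iff₀ hp0]
  have : (1 - 2 * (#A / p : ℝ) + t / p + ξ) * p = p * (1 + ξ) - 2 * #A + t := by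
    field_simp; ring
  linarith

lemma two_mul_card_le_of_sumFree {A : Finset (ZMod p)} (hA : ∀ a ∈ A, ∀ b ∈ A, a + b ∉ A) :
    2 * #A ≤ p := by
  rcases A.eq_empty_or_nonempty with rfl | ⟨a, ha⟩
  · simp
  have hdisj : Disjoint A (A.image (a + ·)) := by
    rw [disjoint_left]
    intro x hx hx'
    obtain ⟨b, hb, rfl⟩ := mem_image.1 hx'
    exact hA a ha b hb hx
  have := card_le_univ (A ∪ A.image (a + ·))
  rw [card_union_of_disjoint hdisj, card_image_of_injective _ (add_right_injective a),
    ZMod.card] at this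
  omega

lemma meanConv_indicator (A : Finset (ZMod p)) (x : ZMod p) :
    meanConv (fun y => if y ∈ A then 1 else 0) (fun y => if y ∈ A then 1 else 0) x =
      (repCount A A x : ℝ) / p := by
  rw [meanConv, Fintype.expect_eq_sum_div_card, ZMod.card, repCount_eq_sum]
  push_cast
  simp_rw [ite_and, mul_ite, mul_one, mul_zero]
  congr 1
  refine sum_congr rfl fun y _ => ?_
  split_ifs <;> rfl

/-- The density bound, under explicit conditions on `p`. The weight is `h = (1 - 1_A * 1_A) ^ k`,
which is `1` on `A` and on `A⁻¹`, and nearly vanishes at every point with at least `10⁻²⁰ p`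
representations in `A + A`. -/
lemma card_lt_of_kloostermanSum_le {k : ℕ} (hk : (1 - 1e-20 : ℝ) ^ k ≤ 1e-10) {κ : ℝ}
    (hkκ : (2 ^ k : ℝ) ^ 2 * κ ≤ 1e-10) (hp : 10 ^ 10 ≤ p)
    {ψ : AddChar (ZMod p) ℂ} (hψ : ψ.IsPrimitive)
    (hκ : ∀ r s, r ≠ 0 ∨ s ≠ 0 → ‖kloostermanSum ψ r s‖ ≤ κ * p)
    {A : Finset (ZMod p)} (hA : ∀ a ∈ A, ∀ b ∈ A, a + b ∉ A) (hinv : ∀ a ∈ A, a⁻¹ ∈ A) :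
    (#A : ℝ) < (0.25 - 1e-10) * p := by
  by_contra! hcon
  have hpr : (10 ^ 10 : ℝ) ≤ p := by exact_mod_cast hp
  have hp0 : (0 : ℝ) < p := by linarith
  have hκ' : ∀ r s, r ≠ 0 ∨ s ≠ 0 → ‖kloostermanSum ψ r s‖ ≤ κ * Fintype.card (ZMod p) := by
    simpa only [ZMod.card] using hκ
  set f : ZMod p → ℝ := fun y => if y ∈ A then 1 else 0 with hf
  have hf0 : ∀ x, 0 ≤ f x := fun x => by simp only [hf]; split_ifs <;> norm_num
  have hf1 : ∀ x, f x ≤ 1 := fun x => by simp only [hf]; split_ifs <;> norm_num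
  have hfabs : ∀ x, |f x| ≤ 1 := fun x => abs_le.2 ⟨by linarith [hf0 x], hf1 x⟩
  set g : ZMod p → ℝ := meanConv f f with hg
  have hg0 : ∀ x, 0 ≤ g x := meanConv_nonneg hf0 hf0
  have hg1 : ∀ x, g x ≤ 1 := meanConv_le_one hf0 hf1 hf1
  have hgr : ∀ x, g x = (repCount A A x : ℝ) / p := meanConv_indicator A
  have hgA : ∀ x ∈ A, g x = 0 := by
    intro x hx
    rw [hgr, repCount, filter_false_of_mem, card_empty, Nat.cast_zero, zero_div]
    intro a ha hxa
    exact hA a ha _ hxa (by rwa [add_sub_cancel])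
  set h : ZMod p → ℝ := fun x => (1 - g x) ^ k with hh
  have hh0 : ∀ x, 0 ≤ h x := fun x => pow_nonneg (sub_nonneg.2 (hg1 x)) k
  have hh1 : ∀ x, h x ≤ 1 := fun x => pow_le_one₀ (sub_nonneg.2 (hg1 x)) (by linarith [hg0 x])
  have hhA : ∀ x ∈ A, h x = 1 := fun x hx => by simp [hh, hgA x hx]
  have hW : WienerBound ψ h (2 ^ k) := by
    have := (WienerBound.one.sub (wienerBound_meanConv hψ hfabs hfabs)).pow k
    rwa [one_add_one_eq_two] at this
  have hdom : ∀ x, f x ≤ h x * h x⁻¹ := by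
    intro x
    by_cases hx : x ∈ A
    · simp [hf, hx, hhA x hx, hhA _ (hinv x hx)]
    · simpa [hf, hx] using mul_nonneg (hh0 x) (hh0 x⁻¹)
  have hα : 𝔼 x, f x = #A / p := by
    rw [Fintype.expect_eq_sum_div_card, ZMod.card]
    simp [hf]
  have hα1 : (0.25 - 1e-10 : ℝ) ≤ #A / p := by rwa [le_div_iff₀ hp0]
  have hαν := expect_le_sq_of_le_mul_inv hψ hκ' hW hdom
  have hν0 : 0 ≤ 𝔼 x, h x := expect_nonneg fun x _ => hh0 x
  -- Popular elements are counted up to multiplicity `t ≈ 10⁻¹⁰ p`. The bound `1 + 2 · 10⁻¹⁰` below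
  -- needs `10⁻²⁰ p ≤ 10⁻¹⁰ t`, which is where the threshold `10⁻²⁰` for `g` comes from.
  obtain ⟨t, ht⟩ : ∃ t, t = p / 10 ^ 10 + 1 := ⟨_, rfl⟩
  have ht1 : (p : ℝ) ≤ 10 ^ 10 * t := by
    have : p ≤ 10 ^ 10 * t := by omega
    exact_mod_cast this
  have ht2 : (t : ℝ) ≤ 2e-10 * p := by
    have : (10 ^ 10 : ℝ) * t ≤ 2 * p := by
      have : 10 ^ 10 * t ≤ 2 * p := by omega
      exact_mod_cast this
    linarith
  have htpos : 0 < t := ht ▸ Nat.succ_pos _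
  have ht0 : (0 : ℝ) < t := by exact_mod_cast htpos
  have htA : t ≤ #A := by
    have : (t : ℝ) ≤ #A := by linarith
    exact_mod_cast this
  have hνle := expect_le_of_add_min_repCount_le (h := h) (ξ := 2e-10) htpos htA
    ((two_mul_card_le_of_sumFree hA).trans (Nat.le_add_right _ _)) (fun x => by
      rcases le_or_gt (1e-20) (g x) with hx | hx
      · have h1 : h x ≤ 1e-10 :=
          (pow_le_pow_left₀ (sub_nonneg.2 (hg1 x)) (by linarith) k).trans hk
        have h2 : ((min t (repCount A A x) : ℕ) : ℝ) / t ≤ 1 :=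
          (div_le_one ht0).2 (by exact_mod_cast min_le_left _ _)
        linarith
      · have h2 : ((min t (repCount A A x) : ℕ) : ℝ) / t ≤ 1e-10 := by
          rw [div_le_iff₀ ht0]
          rw [hgr, div_lt_iff₀ hp0] at hx
          have : ((min t (repCount A A x) : ℕ) : ℝ) ≤ repCount A A x := by
            exact_mod_cast min_le_right _ _
          linarith
        linarith [hh1 x])
  have htp : (t : ℝ) / p ≤ 2e-10 := by rwa [div_le_iff₀ hp0]
  have hν1 : 𝔼 x, h x ≤ 0.5 + 6e-10 := by linarith
  have hν2 : 0.48 ≤ 𝔼 x, h x := by nlinarith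
  have hT := expect_mul_meanConv_self_ge hh0 hh1 hν2 (le_trans (by norm_num) hp)
  -- `f` is supported on `A`, where `f * f` vanishes: `A` has no Schur triples.
  have hT0 : 𝔼 x, f x * meanConv f f x = 0 := by
    refine expect_eq_zero fun x _ => ?_
    by_cases hx : x ∈ A
    · rw [← hg, hgA x hx, mul_zero]
    · simp [hf, hx]
  have hfinal := expect_pow_three_mul_schur_le hψ hκ' hW hdom hf0 hf1 hh0 hh1 (η := 1e-9)
    (by norm_num) (by nlinarith)
  rw [hT0] at hfinal
  have hν3 : (0.1 : ℝ) ≤ (𝔼 x, h x) ^ 3 :=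
    le_trans (by norm_num) (pow_le_pow_left₀ (by norm_num) hν2 3)
  nlinarith

/-- Fixing `k` first and then `κ` small in terms of `k`, the fourth-moment bound supplies the
hypothesis on Kloosterman sums for all large `p`. -/
theorem exists_forall_card_lt :
    ∃ N : ℕ, ∀ p : ℕ, [Fact p.Prime] → N ≤ p → ∀ A : Finset (ZMod p),
      (∀ a ∈ A, ∀ b ∈ A, a + b ∉ A) → (∀ a ∈ A, a⁻¹ ∈ A) → (#A : ℝ) < (0.25 - 1e-10) * p := by
  obtain ⟨k, hk⟩ := exists_pow_lt_of_lt_one (show (0 : ℝ) < 1e-10 by norm_num)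
    (show (1 - 1e-20 : ℝ) < 1 by norm_num)
  set κ : ℝ := 1e-10 / (2 ^ k) ^ 2 with hκ
  have hκ0 : 0 < κ := by positivity
  obtain ⟨M, hM⟩ := exists_nat_ge (5 / κ ^ 4)
  refine ⟨M + 1 + 10 ^ 10, fun p _ hNp A hA hinv => ?_⟩
  refine card_lt_of_kloostermanSum_le hk.le (κ := κ) (by rw [hκ]; field_simp; rfl) (by omega)
    (ZMod.isPrimitive_stdAddChar p) (fun r s hrs => ?_) hA hinv
  have hb := norm_kloostermanSum_pow_four_le (ZMod.isPrimitive_stdAddChar p) hrs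
  rw [ZMod.card] at hb
  have hp1 : (M : ℝ) ≤ p - 1 := by
    have : ((M + 1 : ℕ) : ℝ) ≤ p := by exact_mod_cast (by omega)
    push_cast at this
    linarith
  have h5 : 5 ≤ ((p : ℝ) - 1) * κ ^ 4 := by
    rw [div_le_iff₀ (by positivity)] at hM
    exact hM.trans (by gcongr)
  have hp1' : (0 : ℝ) < p - 1 := by
    by_contra! hneg
    nlinarith [pow_pos hκ0 4]
  refine le_of_pow_le_pow_left₀ (n := 4) (by norm_num) (by positivity) ?_
  refine le_of_mul_le_mul_left (hb.trans ?_) hp1'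
  rw [mul_pow, ← mul_assoc]
  gcongr

end PrimeField

theorem theorem1 :
    ∃ c : ℝ, 0 < c ∧
      ∃ g : ℕ → ℝ, g =o[Filter.atTop] (fun n : ℕ => (n : ℝ)) ∧
        ∀ (F : Type*) [Field F], (Nat.card F).Prime →
          ∀ A : Set F, IsSumFree A → IsInverseClosed A →
            (A.ncard : ℝ) < (0.25 - c) * (Nat.card F : ℝ) + g (Nat.card F) := by
  classical
  obtain ⟨N, hN⟩ := exists_forall_card_lt
  -- The error term only absorbs the finitely many small fields, so it is eventually zero.
  refine ⟨1e-10, by norm_num, fun n => if n < N then n + 1 else 0, ?_, ?_⟩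
  · refine (isLittleO_zero _ _).congr' ?_ Filter.EventuallyEq.rfl
    filter_upwards [Filter.eventually_ge_atTop N] with n hn
    exact (if_neg hn.not_gt).symm
  intro F _ hprime A hsum hinv
  have hfin : Finite F := Nat.finite_of_card_ne_zero hprime.ne_zero
  have : Fintype F := Fintype.ofFinite F
  have : Fact (Nat.card F).Prime := ⟨hprime⟩
  by_cases hlt : Nat.card F < N
  · simp only [hlt, if_true]
    have hA : (A.ncard : ℝ) ≤ Nat.card F := by
      exact_mod_cast A.ncard_le_card
    have : (0 : ℝ) ≤ (0.25 - 1e-10) * (Nat.card F : ℝ) := by positivity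
    linarith
  · simp only [hlt, if_false, add_zero]
    have e : ZMod (Nat.card F) ≃+* F := ZMod.ringEquivOfPrime F hprime Nat.card_eq_fintype_card.symm
    have hmem : ∀ x, x ∈ A.toFinset.map e.symm.toEquiv.toEmbedding ↔ e x ∈ A := by
      intro x
      simp
    have key := hN (Nat.card F) (not_lt.1 hlt) (A.toFinset.map e.symm.toEquiv.toEmbedding) ?_ ?_
    · rwa [Finset.card_map, ← Set.ncard_eq_toFinset_card'] at key
    · intro a ha b hb hab
      rw [hmem] at ha hb hab
      rw [map_add] at hab
      exact (Set.eq_empty_iff_forall_notMem.1 hsum) _ ⟨hab, Set.add_mem_add ha hb⟩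
    · intro a ha
      rw [hmem] at ha ⊢
      rw [map_inv₀, hinv.2]
      exact Set.inv_mem_inv.2 ha
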